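/- Fix a set $A\subseteq\mathbb N$ of admissible arities with $1\in A$ (for example $A=\mathbb N$, no restriction; or $A=\{n\ge 1\}$, every vertex has at least one input and one output). A tensor scheme $D$ consists of sets $Ob(D)$, $Mor(D)$ and maps $s,t:Mor(D)\to W(Ob(D))$ to the free monoid $W(Ob(D))$ of words in $Ob(D)$, such that all words $s(f),t(f)$ have length in $A$; a morphism of tensor schemes is a pair of maps (on objects, on morphisms) commuting with $s$ and $t$. For a small strict tensor category $V$ let $U(V)$ be the tensor scheme whose objects are those of $V$ and whose morphisms are the prime diagrams in $V$, i.e. triples consisting of a word $x_1\cdots x_m$ (source), a word $y_1\cdots y_n$ (target) with $m,n\in A$, and a morphism $x_1\otimes\cdots\otimes x_m\to y_1\otimes\cdots\otimes y_n$ of $V$. The functor $U$ from small strict tensor categories and strict tensor functors to tensor schemes has the left adjoint $F$, where $F(D)$ is the free strict tensor category on $D$ (objects: words in $Ob(D)$; morphisms: isomorphism classes of planar diagrams in $D$). Let $T=UF$ be the resulting monad. A tensor manifold is a $T$-algebra $(D,\epsilon)$, $\epsilon=(\epsilon_o,\epsilon_m):T(D)\to D$, and $\Phi$ is the comparison functor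 $V\mapsto (U(V),U(\text{counit}_V))$ from small strict tensor categories to tensor manifolds. For a tensor manifold $(D,\epsilon)$ and a morphism $d:a\to b$ of $F(D)$, write $\epsilon_m(d):\epsilon_o(a)\to\epsilon_o(b)$ for the value of $\epsilon_m$ at the prime diagram with source the one-letter word $(a)$, target the one-letter word $(b)$ and vertex $d$. Let $\Psi(D,\epsilon)$ be the following strict tensor category: its objects are those of $D$; its morphisms $x\to y$ are the morphisms of $D$ whose source is the one-letter word $x$ and whose target is the one-letter word $y$; the unit object is $\epsilon_o(\emptyset)$ and $x\otimes y=\epsilon_o(xy)$; and $f\otimes g=\epsilon_m(f\otimes g)$, $g\circ f=\epsilon_m(g\circ f)$, $Id_x=\epsilon_m(Id_x)$, where on the right-hand sides the operations are those of $F(D)$. Let $\epsilon_*:(D,\epsilon)\to\Phi\Psi(D,\epsilon)$ be the morphism of tensor manifolds which is the identity on objects and sends $f:x_1\cdots x_m\to y_1\cdots y_n$ to the prime diagram with source $x_1\cdots x_m$, target $y_1\cdots y_n$ and vertex $\theta(f)=\epsilon_m(f):\epsilon_o(x_1\cdots x_m)\to\epsilon_o(y_1\cdots y_n)$, where $f$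 is regarded as a one-vertex diagram of $F(D)$. Call $(D,\epsilon)$ critical if it is isomorphic, as a tensor manifold, to $\Phi(V)$ for some small strict tensor category $V$. Then $(D,\epsilon)$ is critical if and only if $\epsilon_*:(D,\epsilon)\to\Phi\Psi(D,\epsilon)$ is an isomorphism of tensor manifolds. -/

import Mathlib

open CategoryTheory

universe u

theorem wordMap_map {X Y Z : Type u} (g : Y → Z) (f : X → Y) (a : FreeMonoid X) :
    FreeMonoid.map g (FreeMonoid.map f a) = FreeMonoid.map (fun x => g (f x)) a :=
  FreeMonoid.map_map

theorem length_wordMap {X Y : Type u} (f : X → Y) (a : FreeMonoid X) :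
    (FreeMonoid.map f a).length = a.length := by
  simp [FreeMonoid.length]

/-- A tensor scheme whose morphisms have sources and targets that are words in the objects,
with lengths in the set `A` of admissible arities (`A = Set.univ` puts no restriction). -/
structure TensorScheme (A : Set ℕ) where
  Ob : Type u
  Mor : Type u
  source : Mor → FreeMonoid Ob
  target : Mor → FreeMonoid Ob
  source_mem : ∀ f, (source f).length ∈ A
  target_mem : ∀ f, (target f).length ∈ A

namespace TensorScheme

variable {A : Set ℕ}

/-- A morphism of tensor schemes: maps on objects and on morphisms compatible with sources and
targets, where the map on objects is extended letterwise to words. -/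
@[ext]
structure Hom (D E : TensorScheme.{u} A) where
  ob : D.Ob → E.Ob
  mor : D.Mor → E.Mor
  source_mor : ∀ f, E.source (mor f) = FreeMonoid.map ob (D.source f)
  target_mor : ∀ f, E.target (mor f) = FreeMonoid.map ob (D.target f)

instance : Category (TensorScheme.{u} A) where
  Hom := Hom
  id D := ⟨fun x => x, fun f => f, fun f => (DFunLike.congr_fun FreeMonoid.map_id _).symm,
    fun f => (DFunLike.congr_fun FreeMonoid.map_id _).symm⟩
  comp φ ψ := ⟨fun x => ψ.ob (φ.ob x), fun f => ψ.mor (φ.mor f),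
    fun f => by rw [ψ.source_mor, φ.source_mor, wordMap_map],
    fun f => by rw [ψ.target_mor, φ.target_mor, wordMap_map]⟩

@[ext]
theorem hom_ext {D E : TensorScheme.{u} A} {φ ψ : D ⟶ E} (h₁ : ∀ x, φ.ob x = ψ.ob x)
    (h₂ : ∀ f, φ.mor f = ψ.mor f) : φ = ψ :=
  Hom.ext (funext h₁) (funext h₂)

end TensorScheme

/-- A small strict tensor category: a small category whose sets of objects and of morphisms are
monoids (under the tensor product) in such a way that source, target, identities and composition
are multiplicative. Equivalently, a strict monoidal category with strictly associative and
strictly unital tensor product. `comp g f` is the composite "`f` first, then `g`". -/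
structure StrictTensorCat where
  Ob : Type u
  Mor : Type u
  [obMonoid : Monoid Ob]
  [morMonoid : Monoid Mor]
  src : Mor →* Ob
  tgt : Mor →* Ob
  ident : Ob →* Mor
  comp : ∀ g f : Mor, tgt f = src g → Mor
  src_ident : ∀ x, src (ident x) = x
  tgt_ident : ∀ x, tgt (ident x) = x
  src_comp : ∀ g f h, src (comp g f h) = src f
  tgt_comp : ∀ g f h, tgt (comp g f h) = tgt g
  comp_ident : ∀ f x h, comp f (ident x) h = f
  ident_comp : ∀ f x h, comp (ident x) f h = f
  assoc : ∀ k g f h₁ h₂ h₃ h₄, comp (comp k g h₁) f h₂ = comp k (comp g f h₃) h₄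
  interchange : ∀ g f g' f' h h' h'',
    comp (g * g') (f * f') h'' = comp g f h * comp g' f' h'

namespace StrictTensorCat

attribute [instance] obMonoid morMonoid

/-- A strict tensor functor: a functor that strictly preserves tensor products and the unit. -/
@[ext]
structure Hom (V W : StrictTensorCat.{u}) where
  ob : V.Ob →* W.Ob
  mor : V.Mor →* W.Mor
  src_mor : ∀ f, W.src (mor f) = ob (V.src f)
  tgt_mor : ∀ f, W.tgt (mor f) = ob (V.tgt f)
  mor_ident : ∀ x, mor (V.ident x) = W.ident (ob x)
  mor_comp : ∀ g f h h', mor (V.comp g f h) = W.comp (mor g) (mor f) h'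

theorem Hom.composable {V W : StrictTensorCat.{u}} (φ : Hom V W) {g f : V.Mor}
    (h : V.tgt f = V.src g) : W.tgt (φ.mor f) = W.src (φ.mor g) := by
  rw [φ.tgt_mor, φ.src_mor, h]

instance : Category StrictTensorCat.{u} where
  Hom := Hom
  id V := ⟨MonoidHom.id _, MonoidHom.id _, fun _ => rfl, fun _ => rfl, fun _ => rfl,
    fun _ _ _ _ => rfl⟩
  comp φ ψ := ⟨ψ.ob.comp φ.ob, ψ.mor.comp φ.mor,
    fun f => by simp [ψ.src_mor, φ.src_mor], fun f => by simp [ψ.tgt_mor, φ.tgt_mor],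
    fun x => by simp [ψ.mor_ident, φ.mor_ident],
    fun g f h h' => (congrArg ψ.mor (φ.mor_comp g f h (φ.composable h))).trans
      (ψ.mor_comp _ _ (φ.composable h) h')⟩

@[ext]
theorem hom_ext {V W : StrictTensorCat.{u}} {φ ψ : V ⟶ W} (h₁ : ∀ x, φ.ob x = ψ.ob x)
    (h₂ : ∀ f, φ.mor f = ψ.mor f) : φ = ψ :=
  Hom.ext (MonoidHom.ext h₁) (MonoidHom.ext h₂)

theorem comp_congr (V : StrictTensorCat.{u}) {g g' f f' : V.Mor} (hg : g = g') (hf : f = f')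
    (h : V.tgt f = V.src g) (h' : V.tgt f' = V.src g') : V.comp g f h = V.comp g' f' h' := by
  subst hg hf; rfl

/-- The tensor product in `V` of a word of objects; the empty word gives the unit object. -/
def tensorWord (V : StrictTensorCat.{u}) : FreeMonoid V.Ob →* V.Ob :=
  FreeMonoid.lift fun x => x

/-- A prime diagram in `V`: a word `dom = x₁ ⋯ xₘ`, a word `cod = y₁ ⋯ yₙ` (with `m, n ∈ A`) and
a morphism `val : x₁ ⊗ ⋯ ⊗ xₘ → y₁ ⊗ ⋯ ⊗ yₙ` of `V`. -/
@[ext]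
structure PrimeDiagram (A : Set ℕ) (V : StrictTensorCat.{u}) where
  dom : FreeMonoid V.Ob
  cod : FreeMonoid V.Ob
  val : V.Mor
  dom_mem : dom.length ∈ A
  cod_mem : cod.length ∈ A
  src_val : V.src val = V.tensorWord dom
  tgt_val : V.tgt val = V.tensorWord cod

theorem Hom.tensorWord_map {V W : StrictTensorCat.{u}} (φ : V ⟶ W) (a : FreeMonoid V.Ob) :
    W.tensorWord (FreeMonoid.map φ.ob a) = φ.ob (V.tensorWord a) := by
  have h : W.tensorWord.comp (FreeMonoid.map φ.ob) = φ.ob.comp V.tensorWord :=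
    FreeMonoid.hom_eq fun _ => rfl
  exact DFunLike.congr_fun h a

/-- The underlying tensor scheme of a strict tensor category: the same objects, and the prime
diagrams as morphisms. -/
def U (A : Set ℕ) : StrictTensorCat.{u} ⥤ TensorScheme.{u} A where
  obj V :=
    { Ob := V.Ob
      Mor := PrimeDiagram A V
      source := PrimeDiagram.dom
      target := PrimeDiagram.cod
      source_mem := PrimeDiagram.dom_mem
      target_mem := PrimeDiagram.cod_mem }
  map φ :=
    { ob := φ.ob
      mor := fun f =>
        { dom := FreeMonoid.map φ.ob f.dom
          cod := FreeMonoid.map φ.ob f.cod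
          val := φ.mor f.val
          dom_mem := (length_wordMap _ _).symm ▸ f.dom_mem
          cod_mem := (length_wordMap _ _).symm ▸ f.cod_mem
          src_val := by rw [φ.src_mor, f.src_val, Hom.tensorWord_map]
          tgt_val := by rw [φ.tgt_mor, f.tgt_val, Hom.tensorWord_map] }
      source_mor := fun _ => rfl
      target_mor := fun _ => rfl }
  map_id V := by
    refine TensorScheme.hom_ext (fun _ => rfl) (fun f => PrimeDiagram.ext ?_ ?_ rfl)
    · exact DFunLike.congr_fun FreeMonoid.map_id _
    · exact DFunLike.congr_fun FreeMonoid.map_id _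
  map_comp φ ψ := by
    refine TensorScheme.hom_ext (fun _ => rfl) (fun f => PrimeDiagram.ext ?_ ?_ rfl)
    · exact (wordMap_map ψ.ob φ.ob f.dom).symm
    · exact (wordMap_map ψ.ob φ.ob f.cod).symm

end StrictTensorCat

namespace TensorScheme

variable {A : Set ℕ}

/-- Formal expressions for the morphisms of the free strict tensor category on `D`. -/
inductive Raw (D : TensorScheme.{u} A) : FreeMonoid D.Ob → FreeMonoid D.Ob → Type u
  | ident (a : FreeMonoid D.Ob) : Raw D a a
  | gen (f : D.Mor) : Raw D (D.source f) (D.target f)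
  | comp {a b c : FreeMonoid D.Ob} (g : Raw D b c) (f : Raw D a b) : Raw D a c
  | tensor {a b c d : FreeMonoid D.Ob} (f : Raw D a b) (g : Raw D c d) : Raw D (a * c) (b * d)

/-- The congruence on formal expressions generated by the axioms of a strict tensor category. -/
inductive Rel (D : TensorScheme.{u} A) :
    ∀ {a b a' b' : FreeMonoid D.Ob}, Raw D a b → Raw D a' b' → Prop
  | refl {a b : FreeMonoid D.Ob} (f : Raw D a b) : Rel D f f
  | symm {a b a' b' : FreeMonoid D.Ob} {f : Raw D a b} {g : Raw D a' b'} :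
      Rel D f g → Rel D g f
  | trans {a b a' b' a'' b'' : FreeMonoid D.Ob} {f : Raw D a b} {g : Raw D a' b'}
      {h : Raw D a'' b''} : Rel D f g → Rel D g h → Rel D f h
  | comp_congr {a b c a' b' c' : FreeMonoid D.Ob} {g : Raw D b c} {f : Raw D a b}
      {g' : Raw D b' c'} {f' : Raw D a' b'} :
      Rel D g g' → Rel D f f' → Rel D (g.comp f) (g'.comp f')
  | tensor_congr {a b c d a' b' c' d' : FreeMonoid D.Ob} {f : Raw D a b} {g : Raw D c d}
      {f' : Raw D a' b'} {g' : Raw D c' d'} :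
      Rel D f f' → Rel D g g' → Rel D (f.tensor g) (f'.tensor g')
  | comp_ident {a b : FreeMonoid D.Ob} (f : Raw D a b) : Rel D (f.comp (Raw.ident a)) f
  | ident_comp {a b : FreeMonoid D.Ob} (f : Raw D a b) : Rel D ((Raw.ident b).comp f) f
  | comp_assoc {a b c d : FreeMonoid D.Ob} (h : Raw D c d) (g : Raw D b c) (f : Raw D a b) :
      Rel D ((h.comp g).comp f) (h.comp (g.comp f))
  | tensor_assoc {a b a' b' a'' b'' : FreeMonoid D.Ob} (f : Raw D a b) (g : Raw D a' b')
      (h : Raw D a'' b'') : Rel D ((f.tensor g).tensor h) (f.tensor (g.tensor h))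
  | one_tensor {a b : FreeMonoid D.Ob} (f : Raw D a b) : Rel D ((Raw.ident 1).tensor f) f
  | tensor_one {a b : FreeMonoid D.Ob} (f : Raw D a b) : Rel D (f.tensor (Raw.ident 1)) f
  | ident_tensor (a b : FreeMonoid D.Ob) :
      Rel D ((Raw.ident a).tensor (Raw.ident b)) (Raw.ident (a * b))
  | interchange {a b c a' b' c' : FreeMonoid D.Ob} (g : Raw D b c) (f : Raw D a b)
      (g' : Raw D b' c') (f' : Raw D a' b') :
      Rel D ((g.tensor g').comp (f.tensor f')) ((g.comp f).tensor (g'.comp f'))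

theorem Rel.dom_cod {D : TensorScheme.{u} A} {a b a' b' : FreeMonoid D.Ob} {f : Raw D a b}
    {g : Raw D a' b'} (h : Rel D f g) : a = a' ∧ b = b' := by
  induction h <;> simp_all [mul_assoc]

/-- A formal expression together with its source and target words. -/
structure Term (D : TensorScheme.{u} A) where
  {dom cod : FreeMonoid D.Ob}
  raw : Raw D dom cod

instance termSetoid (D : TensorScheme.{u} A) : Setoid D.Term where
  r f g := Rel D f.raw g.raw
  iseqv := ⟨fun f => Rel.refl f.raw, Rel.symm, Rel.trans⟩

/-- The morphisms of the free strict tensor category on `D`; these are the isomorphism classes of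
progressive planar (string) diagrams in `D`, presented by generators and relations. -/
def FreeMor (D : TensorScheme.{u} A) : Type u := Quotient D.termSetoid

namespace FreeMor

variable {D : TensorScheme.{u} A}

/-- The class of a formal expression. -/
def mk {a b : FreeMonoid D.Ob} (f : Raw D a b) : D.FreeMor := Quotient.mk _ ⟨f⟩

theorem sound {a b a' b' : FreeMonoid D.Ob} {f : Raw D a b} {g : Raw D a' b'} (h : Rel D f g) :
    mk f = mk g := Quotient.sound h

theorem ind {P : D.FreeMor → Prop} (h : ∀ {a b : FreeMonoid D.Ob} (f : Raw D a b), P (mk f))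
    (f : D.FreeMor) : P f := Quotient.ind (fun t => h t.raw) f

instance : Monoid D.FreeMor where
  mul := Quotient.map₂ (fun f g => ⟨f.raw.tensor g.raw⟩) (fun _ _ h _ _ h' => h.tensor_congr h')
  one := mk (Raw.ident 1)
  mul_assoc f g h := by
    induction f using ind; induction g using ind; induction h using ind
    exact sound (Rel.tensor_assoc _ _ _)
  one_mul f := by
    induction f using ind
    exact sound (Rel.one_tensor _)
  mul_one f := by
    induction f using ind
    exact sound (Rel.tensor_one _)

theorem mk_tensor {a b c d : FreeMonoid D.Ob} (f : Raw D a b) (g : Raw D c d) :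
    mk (f.tensor g) = mk f * mk g := rfl

/-- The source word. -/
def dom : D.FreeMor →* FreeMonoid D.Ob where
  toFun := Quotient.lift Term.dom (fun _ _ h => (Rel.dom_cod h).1)
  map_one' := rfl
  map_mul' f g := by
    induction f using ind; induction g using ind; rfl

/-- The target word. -/
def cod : D.FreeMor →* FreeMonoid D.Ob where
  toFun := Quotient.lift Term.cod (fun _ _ h => (Rel.dom_cod h).2)
  map_one' := rfl
  map_mul' f g := by
    induction f using ind; induction g using ind; rfl

theorem dom_mk {a b : FreeMonoid D.Ob} (f : Raw D a b) : dom (mk f) = a := rfl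

theorem cod_mk {a b : FreeMonoid D.Ob} (f : Raw D a b) : cod (mk f) = b := rfl

/-- The identity morphism of a word. -/
def ident : FreeMonoid D.Ob →* D.FreeMor where
  toFun a := mk (Raw.ident a)
  map_one' := rfl
  map_mul' a b := (sound (Rel.ident_tensor a b)).symm

open Classical in
/-- Composition, extended by a dummy value to pairs that are not composable. -/
noncomputable def compAux (g f : D.FreeMor) : D.FreeMor :=
  Quotient.lift₂ (fun g f : D.Term =>
      if h : f.cod = g.dom then mk (g.raw.comp (h ▸ f.raw)) else mk g.raw)
    (by
      rintro ⟨g⟩ ⟨f⟩ ⟨g'⟩ ⟨f'⟩ (hg : Rel D g g') (hf : Rel D f f')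
      obtain ⟨rfl, rfl⟩ := hg.dom_cod
      obtain ⟨rfl, rfl⟩ := hf.dom_cod
      dsimp only
      split_ifs with h
      · subst h
        exact sound (hg.comp_congr hf)
      · exact sound hg) g f

theorem compAux_mk {a b c : FreeMonoid D.Ob} (g : Raw D b c) (f : Raw D a b) :
    compAux (mk g) (mk f) = mk (g.comp f) :=
  dif_pos rfl

/-- Every composable pair comes from a composable pair of formal expressions. -/
theorem ind₂ {P : D.FreeMor → D.FreeMor → Prop}
    (H : ∀ {a b c : FreeMonoid D.Ob} (g : Raw D b c) (f : Raw D a b), P (mk g) (mk f))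
    (g f : D.FreeMor) (h : cod f = dom g) : P g f := by
  induction g using ind with
  | h g =>
    induction f using ind with
    | h f =>
      rw [cod_mk, dom_mk] at h
      subst h
      exact H g f

theorem dom_comp (g f : D.FreeMor) (h : cod f = dom g) : dom (compAux g f) = dom f :=
  ind₂ (P := fun g f => dom (compAux g f) = dom f)
    (fun g f => by rw [compAux_mk, dom_mk, dom_mk]) g f h

theorem cod_comp (g f : D.FreeMor) (h : cod f = dom g) : cod (compAux g f) = cod g :=
  ind₂ (P := fun g f => cod (compAux g f) = cod g)
    (fun g f => by rw [compAux_mk, cod_mk, cod_mk]) g f h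

theorem comp_ident (f : D.FreeMor) (a : FreeMonoid D.Ob) (h : a = dom f) :
    compAux f (ident a) = f := by
  induction f using ind with
  | h f =>
    rw [dom_mk] at h
    subst h
    exact (compAux_mk _ _).trans (sound (Rel.comp_ident f))

theorem ident_comp (f : D.FreeMor) (b : FreeMonoid D.Ob) (h : cod f = b) :
    compAux (ident b) f = f := by
  induction f using ind with
  | h f =>
    rw [cod_mk] at h
    subst h
    exact (compAux_mk _ _).trans (sound (Rel.ident_comp f))

theorem comp_assoc (k g f : D.FreeMor) (h₁ : cod g = dom k) (h₂ : cod f = dom g) :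
    compAux (compAux k g) f = compAux k (compAux g f) := by
  induction k using ind with
  | h k =>
    induction g using ind with
    | h g =>
      induction f using ind with
      | h f =>
        rw [cod_mk, dom_mk] at h₁ h₂
        subst h₁ h₂
        simp only [compAux_mk]
        exact sound (Rel.comp_assoc _ _ _)

theorem interchange (g f g' f' : D.FreeMor) (h : cod f = dom g) (h' : cod f' = dom g') :
    compAux (g * g') (f * f') = compAux g f * compAux g' f' :=
  ind₂ (P := fun g f => compAux (g * g') (f * f') = compAux g f * compAux g' f')
    (fun g f => ind₂ (P := fun g' f' => compAux (mk g * g') (mk f * f') =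
        compAux (mk g) (mk f) * compAux g' f')
      (fun g' f' => by
        rw [← mk_tensor, ← mk_tensor, compAux_mk, compAux_mk, compAux_mk, ← mk_tensor]
        exact sound (Rel.interchange _ _ _ _)) g' f' h') g f h

end FreeMor

/-- The free strict tensor category on the tensor scheme `D`: its objects are the words in the
objects of `D`, its morphisms are the classes of formal expressions. -/
noncomputable def free (D : TensorScheme.{u} A) : StrictTensorCat.{u} where
  Ob := FreeMonoid D.Ob
  Mor := D.FreeMor
  src := FreeMor.dom
  tgt := FreeMor.cod
  ident := FreeMor.ident
  comp g f _ := FreeMor.compAux g f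
  src_ident _ := rfl
  tgt_ident _ := rfl
  src_comp := FreeMor.dom_comp
  tgt_comp := FreeMor.cod_comp
  comp_ident f a h := FreeMor.comp_ident f a h
  ident_comp f b h := FreeMor.ident_comp f b h
  assoc k g f h₁ _ h₃ _ := FreeMor.comp_assoc k g f h₁ h₃
  interchange g f g' f' h h' _ := FreeMor.interchange g f g' f' h h'

section Lift

open StrictTensorCat

variable {D : TensorScheme.{u} A} {V : StrictTensorCat.{u}} (φ : D ⟶ (U A).obj V)

/-- The extension of `φ` to words of objects. -/
def liftOb : FreeMonoid D.Ob →* V.Ob := FreeMonoid.lift φ.ob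

theorem tensorWord_map_ob (a : FreeMonoid D.Ob) :
    V.tensorWord (FreeMonoid.map φ.ob a) = liftOb φ a := by
  have h : V.tensorWord.comp (FreeMonoid.map φ.ob) = liftOb φ :=
    FreeMonoid.hom_eq fun _ => rfl
  exact DFunLike.congr_fun h a

/-- The value in `V` of a formal expression. -/
def evalRaw : ∀ {a b : FreeMonoid D.Ob}, Raw D a b →
    {m : V.Mor // V.src m = liftOb φ a ∧ V.tgt m = liftOb φ b}
  | _, _, .ident a => ⟨V.ident (liftOb φ a), V.src_ident _, V.tgt_ident _⟩
  | _, _, .gen f => ⟨(φ.mor f).val,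
      by rw [← tensorWord_map_ob, ← φ.source_mor]; exact (φ.mor f).src_val,
      by rw [← tensorWord_map_ob, ← φ.target_mor]; exact (φ.mor f).tgt_val⟩
  | _, _, .comp g f => ⟨V.comp (evalRaw g).1 (evalRaw f).1
      ((evalRaw f).2.2.trans (evalRaw g).2.1.symm),
      (V.src_comp _ _ _).trans (evalRaw f).2.1, (V.tgt_comp _ _ _).trans (evalRaw g).2.2⟩
  | _, _, .tensor f g => ⟨(evalRaw f).1 * (evalRaw g).1,
      by rw [map_mul, map_mul, (evalRaw f).2.1, (evalRaw g).2.1],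
      by rw [map_mul, map_mul, (evalRaw f).2.2, (evalRaw g).2.2]⟩

theorem evalRaw_rel {a b a' b' : FreeMonoid D.Ob} {f : Raw D a b} {g : Raw D a' b'}
    (h : Rel D f g) : (evalRaw φ f).1 = (evalRaw φ g).1 := by
  induction h with
  | refl => rfl
  | symm _ ih => exact ih.symm
  | trans _ _ ih ih' => exact ih.trans ih'
  | comp_congr _ _ ih ih' => exact V.comp_congr ih ih' _ _
  | tensor_congr _ _ ih ih' => exact congrArg₂ _ ih ih'
  | comp_ident => exact V.comp_ident _ _ _
  | ident_comp => exact V.ident_comp _ _ _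
  | comp_assoc => exact V.assoc _ _ _ _ _ _ _
  | tensor_assoc => exact mul_assoc _ _ _
  | one_tensor => simp [evalRaw]
  | tensor_one => simp [evalRaw]
  | ident_tensor => simp [evalRaw]
  | interchange => exact V.interchange _ _ _ _ _ _ _

/-- The value in `V` of a morphism of the free strict tensor category. -/
def freeLiftMor : D.FreeMor →* V.Mor where
  toFun := Quotient.lift (fun f : D.Term => (evalRaw φ f.raw).1) (fun _ _ h => evalRaw_rel φ h)
  map_one' := (congrArg V.ident (map_one (liftOb φ))).trans (map_one V.ident)
  map_mul' f g := by
    induction f using FreeMor.ind; induction g using FreeMor.ind; rfl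

/-- The strict tensor functor from the free strict tensor category that extends `φ`. -/
def freeLift : D.free ⟶ V where
  ob := liftOb φ
  mor := freeLiftMor φ
  src_mor f := by
    induction f using FreeMor.ind with
    | h f => exact (evalRaw φ f).2.1
  tgt_mor f := by
    induction f using FreeMor.ind with
    | h f => exact (evalRaw φ f).2.2
  mor_ident _ := rfl
  mor_comp g f h h' := by
    have key : ∀ (g f : D.FreeMor) (_ : f.cod = g.dom)
        (h' : V.tgt (freeLiftMor φ f) = V.src (freeLiftMor φ g)),
        freeLiftMor φ (FreeMor.compAux g f) = V.comp (freeLiftMor φ g) (freeLiftMor φ f) h' :=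
      FreeMor.ind₂ (P := fun g f => ∀ h', freeLiftMor φ (FreeMor.compAux g f) =
        V.comp (freeLiftMor φ g) (freeLiftMor φ f) h')
        (fun g f h' => by rw [FreeMor.compAux_mk]; rfl)
    exact key g f h h'

theorem free_tensorWord (D : TensorScheme.{u} A) (a : FreeMonoid D.Ob) :
    D.free.tensorWord (FreeMonoid.map FreeMonoid.of a) = a := by
  have h : D.free.tensorWord.comp (FreeMonoid.map FreeMonoid.of) = MonoidHom.id _ :=
    FreeMonoid.hom_eq fun _ => rfl
  exact DFunLike.congr_fun h a

/-- The inclusion of the generators. -/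
noncomputable def freeUnit (D : TensorScheme.{u} A) : D ⟶ (U A).obj D.free where
  ob := FreeMonoid.of
  mor f :=
    { dom := FreeMonoid.map FreeMonoid.of (D.source f)
      cod := FreeMonoid.map FreeMonoid.of (D.target f)
      val := FreeMor.mk (Raw.gen f)
      dom_mem := (length_wordMap _ _).symm ▸ D.source_mem f
      cod_mem := (length_wordMap _ _).symm ▸ D.target_mem f
      src_val := (free_tensorWord D _).symm
      tgt_val := (free_tensorWord D _).symm }
  source_mor _ := rfl
  target_mor _ := rfl

theorem freeHom_ext {ψ ψ' : D.free ⟶ V} (h₁ : ∀ x, ψ.ob (FreeMonoid.of x) = ψ'.ob (FreeMonoid.of x))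
    (h₂ : ∀ f, ψ.mor (FreeMor.mk (Raw.gen f)) = ψ'.mor (FreeMor.mk (Raw.gen f))) : ψ = ψ' := by
  have hob : ψ.ob = ψ'.ob := FreeMonoid.hom_eq h₁
  refine StrictTensorCat.hom_ext (fun x => DFunLike.congr_fun hob x) fun f => ?_
  induction f using FreeMor.ind with
  | h f =>
    induction f with
    | ident a =>
      exact (ψ.mor_ident a).trans ((congrArg V.ident (DFunLike.congr_fun hob a)).trans
        (ψ'.mor_ident a).symm)
    | gen f => exact h₂ f
    | comp g f hg hf =>
      rw [← FreeMor.compAux_mk]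
      have := ψ.mor_comp (FreeMor.mk g) (FreeMor.mk f) rfl
        (ψ.composable rfl)
      have h' := ψ'.mor_comp (FreeMor.mk g) (FreeMor.mk f) rfl
        (ψ'.composable rfl)
      exact this.trans ((V.comp_congr hg hf _ _).trans h'.symm)
    | tensor f g hf hg =>
      rw [FreeMor.mk_tensor]
      exact (map_mul ψ.mor _ _).trans ((congrArg₂ _ hf hg).trans (map_mul ψ'.mor _ _).symm)

theorem freeUnit_freeLift (φ : D ⟶ (U A).obj V) : freeUnit D ≫ (U A).map (freeLift φ) = φ := by
  refine hom_ext (fun _ => rfl) fun f => PrimeDiagram.ext ?_ ?_ rfl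
  · exact (wordMap_map _ _ _).trans (φ.source_mor f).symm
  · exact (wordMap_map _ _ _).trans (φ.target_mor f).symm

/-- A strict tensor functor on the free strict tensor category is determined by its restriction
to the generators. -/
theorem freeHom_ext' {ψ ψ' : D.free ⟶ V}
    (h : freeUnit D ≫ (U A).map ψ = freeUnit D ≫ (U A).map ψ') : ψ = ψ' :=
  freeHom_ext (fun x => congrArg (fun φ : D ⟶ (U A).obj V => φ.ob x) h)
    (fun f => congrArg (fun φ : D ⟶ (U A).obj V => (φ.mor f).val) h)

end Lift

end TensorScheme

open TensorScheme StrictTensorCat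

/-- The functor sending a tensor scheme to the free strict tensor category on it. -/
noncomputable def freeFunctor (A : Set ℕ) : TensorScheme.{u} A ⥤ StrictTensorCat.{u} where
  obj D := D.free
  map {_ E} φ := freeLift (φ ≫ freeUnit E)
  map_id D := freeHom_ext' (by
    rw [freeUnit_freeLift, CategoryTheory.Functor.map_id, Category.id_comp, Category.comp_id])
  map_comp φ ψ := freeHom_ext' (by
    rw [freeUnit_freeLift, Functor.map_comp, ← Category.assoc (freeUnit _), freeUnit_freeLift,
      Category.assoc, Category.assoc, freeUnit_freeLift])

/-- The free strict tensor category functor is left adjoint to the underlying tensor scheme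
functor. -/
noncomputable def freeAdj (A : Set ℕ) : freeFunctor.{u} A ⊣ U.{u} A where
  unit :=
    { app := fun D => freeUnit D
      naturality := fun _ E φ => (freeUnit_freeLift (φ ≫ freeUnit E)).symm }
  counit :=
    { app := fun V => freeLift (𝟙 ((U A).obj V))
      naturality := fun V W φ => freeHom_ext' (by
        change freeUnit _ ≫ (U A).map (freeLift ((U A).map φ ≫ freeUnit _) ≫ freeLift (𝟙 _)) =
          freeUnit _ ≫ (U A).map (freeLift (𝟙 _) ≫ φ)
        rw [Functor.map_comp, Functor.map_comp, ← Category.assoc, ← Category.assoc,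
          freeUnit_freeLift, freeUnit_freeLift, Category.assoc, freeUnit_freeLift,
          Category.comp_id, Category.id_comp]) }
  left_triangle_components D := freeHom_ext' (by
    change freeUnit _ ≫ (U A).map (freeLift (freeUnit D ≫ freeUnit _) ≫ freeLift (𝟙 _)) =
      freeUnit _ ≫ (U A).map (𝟙 D.free)
    rw [Functor.map_comp, ← Category.assoc, freeUnit_freeLift, Category.assoc, freeUnit_freeLift,
      CategoryTheory.Functor.map_id])
  right_triangle_components V := freeUnit_freeLift (𝟙 ((U A).obj V))

/-- The monad `T = U F` on tensor schemes has `T D = U (F D)`, its unit sends a morphism of `D` to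
the corresponding one-vertex diagram, and its multiplication evaluates diagrams of diagrams.
A tensor manifold is an algebra for this monad. -/
abbrev TensorManifold (A : Set ℕ) : Type (u + 1) := (freeAdj A).toMonad.Algebra

/-- The comparison functor `Φ` from strict tensor categories to tensor manifolds. -/
noncomputable abbrev Phi (A : Set ℕ) : StrictTensorCat.{u} ⥤ TensorManifold.{u} A :=
  Monad.comparison (freeAdj A)

/-- A tensor manifold is critical if it is isomorphic to `Φ V` for a strict tensor category `V`. -/
def IsCritical {A : Set ℕ} (D : TensorManifold.{u} A) : Prop :=
  ∃ V : StrictTensorCat.{u}, Nonempty (D ≅ (Phi A).obj V)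

namespace TensorManifold

variable {A : Set ℕ}

section

variable (D : TensorManifold.{u} A)

/-- The structure map `ε : T D ⟶ D` of a tensor manifold. -/
noncomputable def str : (U A).obj D.A.free ⟶ D.A := D.a

theorem str_unit : freeUnit D.A ≫ D.str = 𝟙 D.A := D.unit

theorem str_assoc : (U A).map (freeLift (𝟙 ((U A).obj D.A.free))) ≫ D.str =
    (U A).map (freeLift (D.str ≫ freeUnit D.A)) ≫ D.str := D.assoc

/-- The set of objects of `Ψ D`: the objects of `D`. -/
def PsiOb : Type u := D.A.Ob

/-- The value `ε(x₁ ⋯ xₙ)` of a word of objects. -/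
noncomputable def evOb (a : FreeMonoid D.A.Ob) : D.PsiOb := D.str.ob a

theorem evOb_of (x : D.A.Ob) : D.evOb (FreeMonoid.of x) = x :=
  congrArg (fun φ : D.A ⟶ D.A => φ.ob x) D.str_unit

/-- The tensor product of objects is `x ⊗ y = ε(xy)`, the unit object is the value of the empty
word. -/
noncomputable instance : Mul D.PsiOb := ⟨fun x y => D.evOb (FreeMonoid.of x * FreeMonoid.of y)⟩

noncomputable instance : One D.PsiOb := ⟨D.evOb 1⟩

theorem evOb_assoc (w : FreeMonoid (FreeMonoid D.A.Ob)) :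
    D.evOb (FreeMonoid.lift (fun a => a) w) = D.evOb (FreeMonoid.map D.evOb w) := by
  have h := congrArg (fun φ : (U A).obj ((U A).obj D.A.free).free ⟶ D.A => φ.ob w) D.str_assoc
  refine h.trans (congrArg D.str.ob ?_)
  have h' : FreeMonoid.lift (fun a => FreeMonoid.of (D.str.ob a)) = FreeMonoid.map D.evOb :=
    FreeMonoid.hom_eq fun _ => rfl
  exact DFunLike.congr_fun h' w

theorem evOb_mul (a b : FreeMonoid D.A.Ob) : D.evOb (a * b) = D.evOb a * D.evOb b :=
  D.evOb_assoc (FreeMonoid.of a * FreeMonoid.of b)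

theorem evOb_one : D.evOb 1 = 1 := rfl

noncomputable instance : Monoid D.PsiOb where
  mul_assoc x y z := by
    rw [← D.evOb_of x, ← D.evOb_of y, ← D.evOb_of z]
    simp only [← evOb_mul, mul_assoc]
  one_mul x := by
    rw [← D.evOb_of x, ← evOb_one, ← evOb_mul, one_mul]
  mul_one x := by
    rw [← D.evOb_of x, ← evOb_one, ← evOb_mul, mul_one]

/-- The morphisms of `Ψ D`: the morphisms of `D` whose source and target are single objects. -/
@[ext]
structure PsiMor where
  dom : D.A.Ob
  cod : D.A.Ob
  mor : D.A.Mor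
  source_eq : D.A.source mor = FreeMonoid.of dom
  target_eq : D.A.target mor = FreeMonoid.of cod

theorem PsiMor.ext_mor {D : TensorManifold.{u} A} {f g : D.PsiMor} (h : f.mor = g.mor) : f = g := by
  refine PsiMor.ext (FreeMonoid.of_injective ?_) (FreeMonoid.of_injective ?_) h
  · rw [← f.source_eq, ← g.source_eq, h]
  · rw [← f.target_eq, ← g.target_eq, h]

end

section

variable (hA : 1 ∈ A) (D : TensorManifold.{u} A)

/-- A morphism `d : a ⟶ b` of the free strict tensor category, as a prime diagram from the
one-letter word `a` to the one-letter word `b`. -/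
noncomputable def trivialFission (d : D.A.FreeMor) : PrimeDiagram A D.A.free where
  dom := FreeMonoid.of (FreeMor.dom d)
  cod := FreeMonoid.of (FreeMor.cod d)
  val := d
  dom_mem := hA
  cod_mem := hA
  src_val := rfl
  tgt_val := rfl

/-- The value `ε(d)` of a morphism `d : x₁ ⋯ xₘ ⟶ y₁ ⋯ yₙ` of the free strict tensor category,
as a morphism `ε(x₁ ⋯ xₘ) ⟶ ε(y₁ ⋯ yₙ)`. -/
noncomputable def ev (d : D.A.FreeMor) : D.PsiMor where
  dom := D.evOb (FreeMor.dom d)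
  cod := D.evOb (FreeMor.cod d)
  mor := D.str.mor (D.trivialFission hA d)
  source_eq := D.str.source_mor _
  target_eq := D.str.target_mor _

/-- The generator of the free strict tensor category given by a morphism of `Ψ D`. -/
def gen (f : D.PsiMor) : D.A.FreeMor := FreeMor.mk (Raw.gen f.mor)

theorem dom_gen (f : D.PsiMor) : FreeMor.dom (D.gen f) = FreeMonoid.of f.dom := f.source_eq

theorem cod_gen (f : D.PsiMor) : FreeMor.cod (D.gen f) = FreeMonoid.of f.cod := f.target_eq

theorem ev_gen (f : D.PsiMor) : D.ev hA (D.gen f) = f := by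
  refine PsiMor.ext_mor ?_
  have h : D.str.mor ((freeUnit D.A).mor f.mor) = f.mor :=
    congrArg (fun φ : D.A ⟶ D.A => φ.mor f.mor) D.str_unit
  have h' : D.trivialFission hA (D.gen f) = (freeUnit D.A).mor f.mor := by
    refine PrimeDiagram.ext ?_ ?_ rfl
    · change FreeMonoid.of (D.A.source f.mor) = FreeMonoid.map FreeMonoid.of (D.A.source f.mor)
      rw [f.source_eq]; rfl
    · change FreeMonoid.of (D.A.target f.mor) = FreeMonoid.map FreeMonoid.of (D.A.target f.mor)
      rw [f.target_eq]; rfl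
  exact (congrArg D.str.mor h').trans h

/-- The associativity law of the structure map, on diagrams with trivial fission. -/
theorem ev_assoc (X : ((U A).obj D.A.free).FreeMor) :
    D.ev hA (freeLiftMor (𝟙 ((U A).obj D.A.free)) X) =
      D.ev hA (freeLiftMor (D.str ≫ freeUnit D.A) X) := by
  have key : ∀ ψ : ((U A).obj D.A.free).free ⟶ D.A.free,
      D.trivialFission hA (ψ.mor X) = ((U A).map ψ).mor
        { dom := FreeMonoid.of (FreeMor.dom X)
          cod := FreeMonoid.of (FreeMor.cod X)
          val := X
          dom_mem := hA
          cod_mem := hA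
          src_val := rfl
          tgt_val := rfl } := fun ψ =>
    PrimeDiagram.ext (congrArg FreeMonoid.of (ψ.src_mor X))
      (congrArg FreeMonoid.of (ψ.tgt_mor X)) rfl
  refine PsiMor.ext_mor ?_
  refine (congrArg D.str.mor (key (freeLift (𝟙 _)))).trans
    (Eq.trans ?_ (congrArg D.str.mor (key (freeLift (D.str ≫ freeUnit D.A)))).symm)
  exact congrArg (fun φ : (U A).obj ((U A).obj D.A.free).free ⟶ D.A => φ.mor _) D.str_assoc

/-- A diagram of diagrams with a single vertex. -/
noncomputable def gen₂ (d : D.A.FreeMor) : ((U A).obj D.A.free).FreeMor :=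
  FreeMor.mk (Raw.gen (D.trivialFission hA d))

theorem ev_mul (d d' : D.A.FreeMor) :
    D.ev hA (d * d') = D.ev hA (D.gen (D.ev hA d) * D.gen (D.ev hA d')) :=
  D.ev_assoc hA (D.gen₂ hA d * D.gen₂ hA d')

theorem ev_comp (d d' : D.A.FreeMor) (h : FreeMor.cod d' = FreeMor.dom d) :
    D.ev hA (FreeMor.compAux d d') =
      D.ev hA (FreeMor.compAux (D.gen (D.ev hA d)) (D.gen (D.ev hA d'))) := by
  have h₂ : FreeMor.cod (D.gen₂ hA d') = FreeMor.dom (D.gen₂ hA d) := congrArg FreeMonoid.of h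
  have key : ∀ ψ : ((U A).obj D.A.free).free ⟶ D.A.free,
      ψ.mor (FreeMor.compAux (D.gen₂ hA d) (D.gen₂ hA d')) =
        FreeMor.compAux (ψ.mor (D.gen₂ hA d)) (ψ.mor (D.gen₂ hA d')) :=
    fun ψ => ψ.mor_comp _ _ h₂ (ψ.composable h₂)
  have h₃ := D.ev_assoc hA (FreeMor.compAux (D.gen₂ hA d) (D.gen₂ hA d'))
  exact (congrArg (D.ev hA) (key (freeLift (𝟙 _)))).symm.trans
    (h₃.trans (congrArg (D.ev hA) (key (freeLift (D.str ≫ freeUnit D.A)))))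

theorem ev_ident (a : FreeMonoid D.A.Ob) :
    D.ev hA (FreeMor.ident a) = D.ev hA (FreeMor.ident (FreeMonoid.of (D.evOb a))) :=
  D.ev_assoc hA (FreeMor.ident (FreeMonoid.of a))

/-- Tensor product in `Ψ D`: `f ⊗ g` is the value of the diagram `f ⊗ g`. -/
noncomputable def psiMul (f g : D.PsiMor) : D.PsiMor := D.ev hA (D.gen f * D.gen g)

/-- Composition in `Ψ D`: `g ∘ f` is the value of the diagram `g ∘ f`. -/
noncomputable def psiComp (g f : D.PsiMor) : D.PsiMor :=
  D.ev hA (FreeMor.compAux (D.gen g) (D.gen f))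

/-- Identities in `Ψ D`: the identity of `x` is the value of the unitary diagram on `x`. -/
noncomputable def psiIdent (x : D.A.Ob) : D.PsiMor := D.ev hA (FreeMor.ident (FreeMonoid.of x))

theorem ev_mul' (d d' : D.A.FreeMor) :
    D.psiMul hA (D.ev hA d) (D.ev hA d') = D.ev hA (d * d') :=
  (D.ev_mul hA d d').symm

theorem ev_comp' (d d' : D.A.FreeMor) (h : FreeMor.cod d' = FreeMor.dom d) :
    D.psiComp hA (D.ev hA d) (D.ev hA d') = D.ev hA (FreeMor.compAux d d') :=
  (D.ev_comp hA d d' h).symm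

/-- The monoid of morphisms of `Ψ D`. -/
@[reducible]
noncomputable def psiMonoid : Monoid D.PsiMor where
  mul := D.psiMul hA
  one := D.psiIdent hA (1 : D.PsiOb)
  mul_assoc f g h := by
    change D.psiMul hA (D.psiMul hA f g) h = D.psiMul hA f (D.psiMul hA g h)
    rw [← D.ev_gen hA f, ← D.ev_gen hA g, ← D.ev_gen hA h]
    simp only [ev_mul', mul_assoc]
  one_mul f := by
    change D.psiMul hA (D.psiIdent hA (1 : D.PsiOb)) f = f
    have e : D.psiIdent hA (1 : D.PsiOb) = D.ev hA 1 := (D.ev_ident hA 1).symm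
    conv_lhs => rw [← D.ev_gen hA f, e]
    exact (D.ev_mul hA _ _).symm.trans ((congrArg (D.ev hA) (one_mul _)).trans (D.ev_gen hA f))
  mul_one f := by
    change D.psiMul hA f (D.psiIdent hA (1 : D.PsiOb)) = f
    have e : D.psiIdent hA (1 : D.PsiOb) = D.ev hA 1 := (D.ev_ident hA 1).symm
    conv_lhs => rw [← D.ev_gen hA f, e]
    exact (D.ev_mul hA _ _).symm.trans ((congrArg (D.ev hA) (mul_one _)).trans (D.ev_gen hA f))

theorem composable_gen {g f : D.PsiMor} (h : f.cod = g.dom) :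
    FreeMor.cod (D.gen f) = FreeMor.dom (D.gen g) := by
  rw [cod_gen, dom_gen, h]

theorem psiComp_ident (f : D.PsiMor) (x : D.A.Ob) (h : x = f.dom) :
    D.psiComp hA f (D.psiIdent hA x) = f := by
  have h' : FreeMonoid.of x = FreeMor.dom (D.gen f) := by rw [dom_gen, h]
  have e := D.ev_comp' hA (D.gen f) (FreeMor.ident (FreeMonoid.of x)) h'
  rwa [FreeMor.comp_ident _ _ h', ev_gen] at e

theorem psiIdent_comp (f : D.PsiMor) (x : D.A.Ob) (h : f.cod = x) :
    D.psiComp hA (D.psiIdent hA x) f = f := by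
  have h' : FreeMor.cod (D.gen f) = FreeMonoid.of x := by rw [cod_gen, h]
  have e := D.ev_comp' hA (FreeMor.ident (FreeMonoid.of x)) (D.gen f) h'
  rwa [FreeMor.ident_comp _ _ h', ev_gen] at e

theorem psiComp_assoc (k g f : D.PsiMor) (h₁ : g.cod = k.dom) (h₂ : f.cod = g.dom) :
    D.psiComp hA (D.psiComp hA k g) f = D.psiComp hA k (D.psiComp hA g f) := by
  have c₁ := D.composable_gen h₁
  have c₂ := D.composable_gen h₂
  have e₁ := D.ev_comp' hA (FreeMor.compAux (D.gen k) (D.gen g)) (D.gen f)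
    (c₂.trans (FreeMor.dom_comp _ _ c₁).symm)
  have e₂ := D.ev_comp' hA (D.gen k) (FreeMor.compAux (D.gen g) (D.gen f))
    ((FreeMor.cod_comp _ _ c₂).trans c₁)
  rw [ev_gen] at e₁ e₂
  exact e₁.trans ((congrArg (D.ev hA) (FreeMor.comp_assoc _ _ _ c₁ c₂)).trans e₂.symm)

theorem psi_interchange (g f g' f' : D.PsiMor) (h : f.cod = g.dom) (h' : f'.cod = g'.dom) :
    D.psiComp hA (D.psiMul hA g g') (D.psiMul hA f f') =
      D.psiMul hA (D.psiComp hA g f) (D.psiComp hA g' f') := by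
  have c := D.composable_gen h
  have c' := D.composable_gen h'
  refine (D.ev_comp' hA (D.gen g * D.gen g') (D.gen f * D.gen f') ?_).trans ?_
  · rw [map_mul, map_mul, c, c']
  · rw [FreeMor.interchange _ _ _ _ c c']
    exact D.ev_mul hA _ _

/-- The strict tensor category `Ψ D` of a tensor manifold `D`. -/
noncomputable def Psi : StrictTensorCat.{u} :=
  letI := D.psiMonoid hA
  { Ob := D.PsiOb
    Mor := D.PsiMor
    src :=
      { toFun := PsiMor.dom
        map_one' := D.evOb_of _
        map_mul' := fun f g => by
          change D.evOb (FreeMor.dom (D.gen f * D.gen g)) = D.evOb (_ * _)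
          rw [map_mul, dom_gen, dom_gen]; rfl }
    tgt :=
      { toFun := PsiMor.cod
        map_one' := D.evOb_of _
        map_mul' := fun f g => by
          change D.evOb (FreeMor.cod (D.gen f * D.gen g)) = D.evOb (_ * _)
          rw [map_mul, cod_gen, cod_gen]; rfl }
    ident :=
      { toFun := D.psiIdent hA
        map_one' := rfl
        map_mul' := fun x y => by
          refine (D.ev_ident hA _).symm.trans ?_
          refine Eq.trans ?_ (D.ev_mul hA _ _)
          exact congrArg (D.ev hA) (map_mul FreeMor.ident _ _) }
    comp := fun g f _ => D.psiComp hA g f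
    src_ident := fun x => D.evOb_of x
    tgt_ident := fun x => D.evOb_of x
    src_comp := fun g f h => by
      change D.evOb (FreeMor.dom (FreeMor.compAux (D.gen g) (D.gen f))) = f.dom
      rw [FreeMor.dom_comp _ _ (D.composable_gen h), dom_gen, evOb_of]
    tgt_comp := fun g f h => by
      change D.evOb (FreeMor.cod (FreeMor.compAux (D.gen g) (D.gen f))) = g.cod
      rw [FreeMor.cod_comp _ _ (D.composable_gen h), cod_gen, evOb_of]
    comp_ident := fun f x h => D.psiComp_ident hA f x ((D.evOb_of x).symm.trans h)
    ident_comp := fun f x h => D.psiIdent_comp hA f x (h.trans (D.evOb_of x))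
    assoc := fun k g f h₁ _ h₃ _ => D.psiComp_assoc hA k g f h₁ h₃
    interchange := fun g f g' f' h h' _ => D.psi_interchange hA g f g' f' h h' }

theorem psi_tensorWord (a : FreeMonoid D.A.Ob) : (D.Psi hA).tensorWord a = D.evOb a := by
  have h : (D.Psi hA).tensorWord =
      ({ toFun := D.evOb, map_one' := rfl, map_mul' := D.evOb_mul } : _ →* D.PsiOb) :=
    FreeMonoid.hom_eq fun x => (D.evOb_of x).symm
  exact DFunLike.congr_fun h a

/-- The value `θ(f) = ε(f)` of a morphism `f` of `D`, regarded as the prime diagram with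
trivial fission; a morphism of `Ψ D` from the tensor product of the source of `f` to the tensor
product of its target. -/
noncomputable def theta (f : D.A.Mor) : D.PsiMor := D.ev hA (FreeMor.mk (Raw.gen f))

/-- The morphism of tensor schemes underlying `ε_*`: the identity on objects, and `f` is sent to
the prime diagram with the same source and target words as `f`, decorated by `θ(f)`. -/
noncomputable def epsStarScheme : D.A ⟶ (U A).obj (D.Psi hA) where
  ob x := x
  mor f :=
    { dom := D.A.source f
      cod := D.A.target f
      val := D.theta hA f
      dom_mem := D.A.source_mem f
      cod_mem := D.A.target_mem f
      src_val := (D.psi_tensorWord hA _).symm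
      tgt_val := (D.psi_tensorWord hA _).symm }
  source_mor f := (DFunLike.congr_fun FreeMonoid.map_id (D.A.source f)).symm
  target_mor f := (DFunLike.congr_fun FreeMonoid.map_id (D.A.target f)).symm

/-- Evaluation, as a strict tensor functor. -/
noncomputable def evFunctor : D.A.free ⟶ D.Psi hA where
  ob := { toFun := D.evOb, map_one' := rfl, map_mul' := D.evOb_mul }
  mor := { toFun := D.ev hA, map_one' := D.ev_ident hA 1, map_mul' := D.ev_mul hA }
  src_mor _ := rfl
  tgt_mor _ := rfl
  mor_ident a := D.ev_ident hA a
  mor_comp g f h _ := D.ev_comp hA g f h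

theorem freeLift_epsStarScheme : freeLift (D.epsStarScheme hA) = D.evFunctor hA :=
  freeHom_ext (fun x => (D.evOb_of x).symm) (fun _ => rfl)

theorem freeLift_comp_freeLift {D : TensorScheme.{u} A} {V : StrictTensorCat.{u}}
    (φ : D ⟶ (U A).obj V) :
    freeLift (φ ≫ freeUnit ((U A).obj V)) ≫ freeLift (𝟙 ((U A).obj V)) = freeLift φ :=
  freeHom_ext' (by
    rw [CategoryTheory.Functor.map_comp, ← Category.assoc, freeUnit_freeLift, Category.assoc, freeUnit_freeLift,
      freeUnit_freeLift, Category.comp_id])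

theorem theta_str (P : PrimeDiagram A D.A.free) : D.theta hA (D.str.mor P) = D.ev hA P.val :=
  (D.ev_assoc hA (FreeMor.mk (Raw.gen (D := (U A).obj D.A.free) P))).symm

theorem map_evFunctor : (U A).map (D.evFunctor hA) = D.str ≫ D.epsStarScheme hA :=
  hom_ext (fun _ => rfl) fun P => PrimeDiagram.ext (D.str.source_mor P).symm
    (D.str.target_mor P).symm (D.theta_str hA P).symm

/-- The natural morphism of tensor manifolds `ε_* : D ⟶ Φ (Ψ D)`. -/
noncomputable def epsStar : D ⟶ (Phi A).obj (D.Psi hA) where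
  f := D.epsStarScheme hA
  h := by
    change (U A).map (freeLift (D.epsStarScheme hA ≫ freeUnit _)) ≫ (U A).map (freeLift (𝟙 _)) =
      D.str ≫ D.epsStarScheme hA
    rw [← CategoryTheory.Functor.map_comp, freeLift_comp_freeLift, freeLift_epsStarScheme]
    exact D.map_evFunctor hA

end

end TensorManifold

/-! One direction is immediate: if `ε_*` is invertible, then `Ψ D` is a strict tensor category whose
image under `Φ` is isomorphic to `D`.

For the converse, let `i : D ⟶ Φ V` be an isomorphism. A morphism of `Φ V` is a prime diagram: two
words together with a morphism of `V` between their tensor products. The words only type the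
morphism and may be replaced by any admissible words with the same tensor products. Through `i` this
description carries over to `D`, and it has to be compared with the prime diagrams of `Ψ D`. The
comparison rests on two facts, both obtained from the compatibility of `i` with evaluation
(`map_freeLift_hom`). On objects, `i` sends `ε(a)` to the tensor product of the word `i(a)`
(`hom_evOb`). On morphisms, `i(f)` and `i(θ(f))` have the same value in `V` (`hom_theta_val`), so
passing from `f` to `θ(f)` forgets only the words.

Hence `f` is recovered from its source, its target and `θ(f)`, which is injectivity of `ε_*`.
Conversely, a morphism `ε(a) ⟶ ε(b)` of `Ψ D` has an image whose value in `V` can be retyped by the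
words `i(a)` and `i(b)`; pulling the result back along `i` gives surjectivity. Since `ε_*` is the
identity on objects, this makes it an isomorphism of tensor schemes, hence of algebras. Neither the
naturality of `ε_*` nor a comparison of `Ψ (Φ V)` with `V` is needed. -/

/-! ### Isomorphisms of tensor schemes -/

namespace TensorScheme

variable {A : Set ℕ}

/-- A morphism of tensor schemes that is bijective on objects and on morphisms is an
isomorphism. -/
theorem isIso_of_bijective {D E : TensorScheme.{u} A} (φ : D ⟶ E)
    (hob : Function.Bijective φ.ob) (hmor : Function.Bijective φ.mor) : IsIso φ := by
  obtain ⟨o, ho₁, ho₂⟩ := Function.bijective_iff_has_inverse.mp hob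
  obtain ⟨m, hm₁, hm₂⟩ := Function.bijective_iff_has_inverse.mp hmor
  have hword : ∀ a, FreeMonoid.map o (FreeMonoid.map φ.ob a) = a := fun a => by
    rw [wordMap_map]
    simp only [ho₁ _]
    exact DFunLike.congr_fun FreeMonoid.map_id a
  -- The inverse maps respect sources and targets automatically: write `f` as `φ(m f)`, so that its
  -- source is the `φ`-image of the source of `m f`, and cancel `φ` letter by letter.
  let ψ : E ⟶ D :=
    { ob := o
      mor := m
      source_mor := fun f => by
        conv_rhs => rw [← hm₂ f, φ.source_mor, hword]
      target_mor := fun f => by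
        conv_rhs => rw [← hm₂ f, φ.target_mor, hword] }
  exact ⟨ψ, hom_ext ho₁ hm₁, hom_ext ho₂ hm₂⟩

end TensorScheme

/-! ### Morphisms from a tensor manifold to `Φ V` -/

namespace TensorManifold

variable {A : Set ℕ} {D : TensorManifold.{u} A} {V : StrictTensorCat.{u}}

/-- A morphism of tensor manifolds from `D` to `Φ V` commutes with the evaluation of diagrams. -/
theorem map_freeLift_hom (i : D ⟶ (Phi A).obj V) :
    (U A).map (freeLift (V := V) i.f) = D.str ≫ i.f := by
  let φ : D.A ⟶ (U A).obj V := i.f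
  -- This is the algebra square of `i` with `T` and the structure map of `Φ V` unfolded. Its left
  -- side is `U` of a composite of two strict tensor functors, namely the extension of `i` to
  -- diagrams followed by evaluation in `V`.
  have h : (U A).map (freeLift (φ ≫ freeUnit ((U A).obj V))) ≫
      (U A).map (freeLift (𝟙 ((U A).obj V))) = D.str ≫ φ := i.h
  rw [← CategoryTheory.Functor.map_comp, freeLift_comp_freeLift] at h
  exact h

/-- The object part of the compatibility of `i` with evaluation. It is what allows a one-letter
source `ε(a)` to be traded for the word `a` once inside `V`. -/
theorem hom_evOb (i : D ⟶ (Phi A).obj V) (a : FreeMonoid D.A.Ob) :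
    i.f.ob (D.evOb a) = V.tensorWord (FreeMonoid.map i.f.ob a) :=
  (congrArg (fun φ : (U A).obj D.A.free ⟶ (U A).obj V => φ.ob a) (map_freeLift_hom i)).symm.trans
    (tensorWord_map_ob (V := V) i.f a).symm

/-- The morphisms `f` and `θ(f)` have the same underlying morphism of `V`. -/
theorem hom_theta_val (hA : 1 ∈ A) (i : D ⟶ (Phi A).obj V) (f : D.A.Mor) :
    PrimeDiagram.val (V := V) (i.f.mor (D.theta hA f).mor) =
      PrimeDiagram.val (V := V) (i.f.mor f) :=
  -- Compatibility with evaluation is applied to the one-vertex diagram `f` typed by one-letter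
  -- words. One side of the square gives `i(θ(f))`; on the other, the value of the diagram in `V` is
  -- that of its only vertex.
  (congrArg (fun φ : (U A).obj D.A.free ⟶ (U A).obj V =>
    (φ.mor (D.trivialFission hA (FreeMor.mk (Raw.gen f)))).val) (map_freeLift_hom i)).symm

/-! ### Bijectivity of `ε_*` on morphisms -/

/-- The prime diagram `i(f)` is determined by its two words and its value in `V`. The words come
from the source and target of `f`, the value from `θ(f)`, and `ε_*(f)` records all of these. -/
theorem epsStarScheme_injective (hA : 1 ∈ A) (i : D ⟶ (Phi A).obj V)
    (hmor : Function.Injective i.f.mor) : Function.Injective (D.epsStarScheme hA).mor := by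
  intro f g h
  have hs : D.A.source f = D.A.source g := congrArg PrimeDiagram.dom h
  have ht : D.A.target f = D.A.target g := congrArg PrimeDiagram.cod h
  have hθ : D.theta hA f = D.theta hA g := congrArg PrimeDiagram.val h
  refine hmor (PrimeDiagram.ext (V := V) ?_ ?_ ?_)
  · exact (i.f.source_mor f).trans ((congrArg _ hs).trans (i.f.source_mor g).symm)
  · exact (i.f.target_mor f).trans ((congrArg _ ht).trans (i.f.target_mor g).symm)
  · exact (hom_theta_val hA i f).symm.trans
      ((congrArg (fun v : D.PsiMor => PrimeDiagram.val (V := V) (i.f.mor v.mor)) hθ).trans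
        (hom_theta_val hA i g))

/-- The preimage of a prime diagram of `Ψ D` is built in `V`, where a value can be given new words
freely, and then pulled back along `i`. -/
theorem epsStarScheme_surjective (hA : 1 ∈ A) (i : D ⟶ (Phi A).obj V)
    (hob : Function.Injective i.f.ob) (hmor : Function.Bijective i.f.mor) :
    Function.Surjective (D.epsStarScheme hA).mor := by
  intro Q
  let v : D.PsiMor := Q.val
  have hdom : v.dom = D.evOb Q.dom := Q.src_val.trans (D.psi_tensorWord hA _)
  have hcod : v.cod = D.evOb Q.cod := Q.tgt_val.trans (D.psi_tensorWord hA _)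
  let P : PrimeDiagram A V := i.f.mor v.mor
  have hPdom : P.dom = FreeMonoid.of (i.f.ob v.dom) :=
    (i.f.source_mor v.mor).trans (congrArg (FreeMonoid.map i.f.ob) v.source_eq)
  have hPcod : P.cod = FreeMonoid.of (i.f.ob v.cod) :=
    (i.f.target_mor v.mor).trans (congrArg (FreeMonoid.map i.f.ob) v.target_eq)
  -- `P` has one-letter source and target; `R` keeps its value but carries the images of the words
  -- of `Q`. This is legitimate because `i(ε(a))` is the tensor product of `i(a)`.
  let R : PrimeDiagram A V :=
    { dom := FreeMonoid.map i.f.ob Q.dom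
      cod := FreeMonoid.map i.f.ob Q.cod
      val := P.val
      dom_mem := (length_wordMap _ _).symm ▸ Q.dom_mem
      cod_mem := (length_wordMap _ _).symm ▸ Q.cod_mem
      src_val := (P.src_val.trans (congrArg V.tensorWord hPdom)).trans
        ((congrArg i.f.ob hdom).trans (hom_evOb i Q.dom))
      tgt_val := (P.tgt_val.trans (congrArg V.tensorWord hPcod)).trans
        ((congrArg i.f.ob hcod).trans (hom_evOb i Q.cod)) }
  obtain ⟨f, hf⟩ := hmor.2 R
  have hword : Function.Injective (FreeMonoid.map i.f.ob) := List.map_injective_iff.mpr hob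
  have hs : D.A.source f = Q.dom :=
    hword ((i.f.source_mor f).symm.trans (congrArg (PrimeDiagram.dom (V := V)) hf))
  have ht : D.A.target f = Q.cod :=
    hword ((i.f.target_mor f).symm.trans (congrArg (PrimeDiagram.cod (V := V)) hf))
  -- It remains to see that `θ(f) = v`. This is tested after applying `i`: both have source
  -- `ε(Q.dom)` and target `ε(Q.cod)` as single letters, and both have the value of `R` in `V`.
  refine ⟨f, PrimeDiagram.ext hs ht (PsiMor.ext_mor (hmor.1 (PrimeDiagram.ext (V := V) ?_ ?_ ?_)))⟩
  · refine (i.f.source_mor _).trans (Eq.trans ?_ (i.f.source_mor v.mor).symm)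
    refine congrArg (FreeMonoid.map i.f.ob) ?_
    rw [v.source_eq, hdom, ← hs]
    exact (D.theta hA f).source_eq
  · refine (i.f.target_mor _).trans (Eq.trans ?_ (i.f.target_mor v.mor).symm)
    refine congrArg (FreeMonoid.map i.f.ob) ?_
    rw [v.target_eq, hcod, ← ht]
    exact (D.theta hA f).target_eq
  · exact (hom_theta_val hA i f).trans (congrArg (fun P : PrimeDiagram A V => P.val) hf :)

end TensorManifold

/-! ### The criterion for criticality -/

theorem proposition6p4p7 (A : Set ℕ) (hA : 1 ∈ A) (D : TensorManifold.{u} A) :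
    IsCritical D ↔ IsIso (D.epsStar hA) := by
  constructor
  · rintro ⟨V, ⟨e⟩⟩
    have h₁ : e.hom.f ≫ e.inv.f = 𝟙 D.A := congrArg Monad.Algebra.Hom.f e.hom_inv_id
    have h₂ : e.inv.f ≫ e.hom.f = 𝟙 ((Phi A).obj V).A :=
      congrArg Monad.Algebra.Hom.f e.inv_hom_id
    have hob : Function.Injective e.hom.f.ob := Function.LeftInverse.injective
      fun x => congrArg (fun φ : D.A ⟶ D.A => φ.ob x) h₁
    have hmor : Function.Bijective e.hom.f.mor := Function.bijective_iff_has_inverse.mpr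
      ⟨e.inv.f.mor, fun f => congrArg (fun φ : D.A ⟶ D.A => φ.mor f) h₁,
        fun f => congrArg (fun φ : ((Phi A).obj V).A ⟶ ((Phi A).obj V).A => φ.mor f) h₂⟩
    have : IsIso (D.epsStar hA).f := TensorScheme.isIso_of_bijective (D.epsStarScheme hA)
      Function.bijective_id ⟨TensorManifold.epsStarScheme_injective hA e.hom hmor.1,
        TensorManifold.epsStarScheme_surjective hA e.hom hob hmor⟩
    -- The forgetful functor from algebras reflects isomorphisms, so invertibility on tensor schemes
    -- is enough.
    exact Monad.algebra_iso_of_iso _ (D.epsStar hA)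
  · intro _
    exact ⟨D.Psi hA, ⟨asIso (D.epsStar hA)⟩⟩
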